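/- Let $\alpha=(\alpha_1,\dots,\alpha_{2s})$ be a composition of $n$ into an even number of positive parts. The circular fence poset $\overline F(\alpha)$ has $n$ nodes $x_1,\dots,x_n$, with $x_{n+1}=x_1$, and its order is generated by the relations $$x_1\preceq x_2\preceq\cdots\preceq x_{\alpha_1+1}\succeq x_{\alpha_1+2}\succeq\cdots\succeq x_{\alpha_1+\alpha_2+1}\preceq\cdots\preceq x_{\alpha_1+\alpha_2+\alpha_3+1}\succeq\cdots\succeq x_{n+1}=x_1 ,$$ which alternately go up and down along the segments of lengths $\alpha_1,\dots,\alpha_{2s}$. For a finite poset $P$ the rank polynomial of its lattice of lower order ideals is $\sum_I q^{|I|}$, the sum being over all lower order ideals $I$ of $P$; for $P=\overline F(\alpha)$ it is denoted $\overline R(\alpha;q)$. A polynomial $\sum_{i=0}^N a_iq^i$ of degree $N$ is unimodal if $a_0\le\cdots\le a_m\ge\cdots\ge a_N$ for some $m$, and top interlacing if $a_0\le a_N\le a_1\le a_{N-1}\le\cdots\le a_{\lceil N/2\rceil}$. (1) Lemma. Let $T$ be a maximal node of $\overline F(\alpha)$, and let $F_{T^-}$ be the (possibly upside down) fence obtained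 from $\overline F(\alpha)$ by deleting $T$. If the rank polynomial of $F_{T^-}$ is top interlacing, then $\overline R(\alpha;q)$ is unimodal. (2) Corollary. If $\alpha$ has two cyclically consecutive parts that are both greater than $1$, or three cyclically consecutive parts $k,1,l$ with $|k-l|>1$, then $\overline R(\alpha;q)$ is unimodal. -/

import Mathlib

open Polynomial

/-- The rank polynomial `R(P; q) = ∑ q ^ |I|` of the lattice of lower order ideals of a finite
poset `P`, the sum being over all lower order ideals `I` of `P`. -/
noncomputable def rankPolynomial (P : Type*) [PartialOrder P] [Fintype P] : ℕ[X] :=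
  open Classical in
  ∑ I ∈ (Finset.univ : Finset (Finset P)).filter (fun I : Finset P => IsLowerSet (I : Set P)),
    X ^ Finset.card I

/-- The sequence `a 0, a 1, …, a N` is unimodal. -/
def SeqUnimodal (a : ℕ → ℕ) (N : ℕ) : Prop :=
  ∃ m ≤ N, (∀ i, i < m → a i ≤ a (i + 1)) ∧ (∀ i, m ≤ i → i < N → a (i + 1) ≤ a i)

/-- The sequence `a 0, a 1, …, a N` is top interlacing:
`a 0 ≤ a N ≤ a 1 ≤ a (N - 1) ≤ ⋯ ≤ a ⌈N / 2⌉`, a chain that runs through all `N + 1` terms. -/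
def SeqTopInterlacing (a : ℕ → ℕ) (N : ℕ) : Prop :=
  ∀ i, (2 * i + 1 ≤ N → a i ≤ a (N - i)) ∧ (2 * i + 2 ≤ N → a (N - i) ≤ a (i + 1))

/-- A polynomial is unimodal if its sequence of coefficients is. -/
def PolyUnimodal (p : ℕ[X]) : Prop := SeqUnimodal p.coeff p.natDegree

/-- A polynomial is top interlacing if its sequence of coefficients is. -/
def PolyTopInterlacing (p : ℕ[X]) : Prop := SeqTopInterlacing p.coeff p.natDegree

/-- The cyclic successor on `{0, …, n - 1}`. -/
def cyclicSucc {n : ℕ} (j : Fin n) : Fin n := ⟨(j + 1) % n, Nat.mod_lt _ j.pos⟩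

/-- The nodes of the circular fence of a composition `c` of `n` with an even number of parts:
node `j : Fin n` is `x_{j+1}`, and `x_{n+1}` is identified with `x_1`. -/
def CircularFence {n : ℕ} (c : Composition n) (_hc : Even c.length) : Type := Fin n

namespace CircularFence

variable {n : ℕ} {c : Composition n} {hc : Even c.length}

instance : Fintype (CircularFence c hc) := inferInstanceAs (Fintype (Fin n))

instance : DecidableEq (CircularFence c hc) := inferInstanceAs (DecidableEq (Fin n))

/-- The generating relations `x ≤ y`. The edge from node `j` to its cyclic successor belongs to
the part number `c.index j` of `c` (numbered from zero); it goes up in the parts of even number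
(the first, third, … segments) and down in the parts of odd number. -/
def Step (c : Composition n) (x y : Fin n) : Prop :=
  (Even (c.index x : ℕ) ∧ y = cyclicSucc x) ∨ (Odd (c.index y : ℕ) ∧ x = cyclicSucc y)

/-- An auxiliary function that increases along the generating relations. -/
def height (c : Composition n) (v : Fin n) : ℕ :=
  if Even (c.index v : ℕ) then v - c.sizeUpTo (c.index v)
  else if (v : ℕ) = c.sizeUpTo (c.index v) then n
  else c.sizeUpTo (c.index v + 1) - v

theorem index_eq_of (c : Composition n) (v : Fin n) (i : Fin c.length)
    (h1 : c.sizeUpTo i ≤ v) (h2 : (v : ℕ) < c.sizeUpTo (i + 1)) : c.index v = i := by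
  have h : v ∈ Set.range (c.embedding i) := c.mem_range_embedding_iff.2 ⟨h1, h2⟩
  exact (c.mem_range_embedding_iff'.1 h).symm

theorem height_up (c : Composition n) (hc : Even c.length) (x : Fin n)
    (hx : Even (c.index x : ℕ)) : height c x < height c (cyclicSucc x) := by
  have h1 := c.sizeUpTo_index_le x
  have h2 : (x : ℕ) < c.sizeUpTo (c.index x + 1) := c.lt_sizeUpTo_index_succ x
  have hxn := x.2
  have hi : (c.index x : ℕ) + 1 < c.length := by
    have := (c.index x).2
    obtain ⟨a, ha⟩ := hx
    obtain ⟨b, hb⟩ := hc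
    omega
  have h3 : c.sizeUpTo (c.index x + 1) < c.sizeUpTo (c.index x + 1 + 1) :=
    c.sizeUpTo_strict_mono hi
  have h4 := c.sizeUpTo_le (c.index x + 1 + 1)
  have hs : ((cyclicSucc x : Fin n) : ℕ) = x + 1 := Nat.mod_eq_of_lt (by omega)
  rcases Nat.lt_or_ge ((x : ℕ) + 1) (c.sizeUpTo (c.index x + 1)) with h | h
  · have e := index_eq_of c (cyclicSucc x) (c.index x) (by omega) (by omega)
    simp only [height, e, hx, hs, if_true]
    omega
  · have e := index_eq_of c (cyclicSucc x) ⟨c.index x + 1, hi⟩ (by simp only; omega)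
      (by simp only; omega)
    have hodd : ¬ Even ((c.index x : ℕ) + 1) := by simpa [Nat.even_add_one] using hx
    have h5 : (x : ℕ) + 1 = c.sizeUpTo (c.index x + 1) := by omega
    simp only [height, e, hx, hs, if_true, hodd, if_false, h5]
    omega

theorem height_down (c : Composition n) (x : Fin n)
    (hx : Odd (c.index x : ℕ)) : height c (cyclicSucc x) < height c x := by
  have hx' : ¬ Even (c.index x : ℕ) := Nat.not_even_iff_odd.2 hx
  have h1 := c.sizeUpTo_index_le x
  have h2 : (x : ℕ) < c.sizeUpTo (c.index x + 1) := c.lt_sizeUpTo_index_succ x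
  have hxn := x.2
  have h4 := c.sizeUpTo_le (c.index x + 1)
  have hpos : 0 < height c x := by
    simp only [height, hx', if_false]
    split_ifs <;> omega
  rcases Nat.lt_or_ge ((x : ℕ) + 1) (c.sizeUpTo (c.index x + 1)) with h | h
  · have hs : ((cyclicSucc x : Fin n) : ℕ) = x + 1 := Nat.mod_eq_of_lt (by omega)
    have e := index_eq_of c (cyclicSucc x) (c.index x) (by omega) (by omega)
    simp only [height, e, hx', hs, if_false]
    split_ifs <;> omega
  · suffices h0 : height c (cyclicSucc x) = 0 by omega
    rcases Nat.lt_or_ge ((c.index x : ℕ) + 1) c.length with hi | hi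
    · have h3 : c.sizeUpTo (c.index x + 1) < c.sizeUpTo (c.index x + 1 + 1) :=
        c.sizeUpTo_strict_mono hi
      have h5 := c.sizeUpTo_le (c.index x + 1 + 1)
      have hs : ((cyclicSucc x : Fin n) : ℕ) = x + 1 := Nat.mod_eq_of_lt (by omega)
      have e := index_eq_of c (cyclicSucc x) ⟨c.index x + 1, hi⟩ (by simp only; omega)
        (by simp only; omega)
      have hev : Even ((c.index x : ℕ) + 1) := hx.add_one
      simp only [height, e, hs, if_true, hev]
      omega
    · have h5 := c.sizeUpTo_ofLength_le _ hi
      have hs : ((cyclicSucc x : Fin n) : ℕ) = 0 := by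
        have : (x : ℕ) + 1 = n := by omega
        simp [cyclicSucc, this]
      have hl : 0 < c.length := (c.index x).pos
      have h6 : c.sizeUpTo 0 < c.sizeUpTo (0 + 1) := c.sizeUpTo_strict_mono hl
      have e := index_eq_of c (cyclicSucc x) ⟨0, hl⟩ (by simp [hs])
        (by simp only [hs]; omega)
      simp [height, e, hs]

theorem height_lt_of_step (hc : Even c.length) {x y : Fin n} (h : Step c x y) :
    height c x < height c y := by
  rcases h with ⟨h, rfl⟩ | ⟨h, rfl⟩
  · exact height_up c hc x h
  · exact height_down c y h

theorem eq_or_height_lt (hc : Even c.length) {x y : Fin n}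
    (h : Relation.ReflTransGen (Step c) x y) : x = y ∨ height c x < height c y := by
  induction h with
  | refl => exact Or.inl rfl
  | tail _ h ih =>
    right
    have := height_lt_of_step hc h
    rcases ih with rfl | ih
    · exact this
    · exact ih.trans this

/-- The order of the circular fence: the one generated by the relations `Step`. -/
instance : PartialOrder (CircularFence c hc) where
  le x y := Relation.ReflTransGen (Step c) x y
  le_refl _ := Relation.ReflTransGen.refl
  le_trans _ _ _ := Relation.ReflTransGen.trans
  le_antisymm x y hxy hyx := by
    rcases eq_or_height_lt hc hxy with h | h
    · exact h
    · rcases eq_or_height_lt hc hyx with h' | h'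
      · exact h'.symm
      · exact absurd h' (lt_asymm h)

end CircularFence

/-! Ideals are counted by transfer matrices. Reading a fence as a word of up and down letters,
`pathSum w` is a product of 2 × 2 matrices over ℤ[X], indexed by the states (out or in) of the end
nodes, and `cycleSum` is a trace. One matrix with determinant -(1 - X + X²) conjugates the up matrix
to the down matrix and conversely, so a circular fence and its dual have the same polynomial
(`cycleSum_not`). Complementing ideals reverses the coefficients of the dual, so circular rank
polynomials are palindromic (`zcoeff_cycleSum`).

Palindromicity controls a fence polynomial F with N nodes. Joining the two ends by an edge, directly
or through a new minimal or maximal node, gives a palindromic polynomial that differs from F or X *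
F by a sum over ideals with prescribed end states. Prescribing an end state forces a run of nodes,
so the correction is zero or X ^ k times a smaller fence polynomial. Induction on N shows that F is
top or bottom interlacing (`IsFencePoly.interlacing`), hence unimodal with mode near N / 2.

If T is maximal, the ideals avoiding T give the polynomial F of the remaining fence, and those
containing T give X * P, where P counts ideals with both ends in. If F is top heavy, both summands
increase up to the middle (`zcoeff_cycleSum_le_of_topHeavy`), and palindromicity gives unimodality.
For the corollary, after rotation, reversal or dualization, T is chosen so that closing up the
remaining fence loses only a polynomial shifted by a large power of X, which makes F top heavy. -/

/-! ### Transfer matrices of fences and circular fences -/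

/-- The weight `q` of a node in the ideal, `1` of a node outside. -/
noncomputable def nodeWeight (s : Bool) : ℤ[X] := if s then X else 1

/-- Whether the states `s`, `t` of consecutive nodes are compatible with an ideal: along an up edge
(`b = true`) the first lies in the ideal if the second does, along a down edge conversely. -/
def edgeOK : Bool → Bool → Bool → Bool
  | true, false, true => false
  | false, true, false => false
  | _, _, _ => true

/-- The generating polynomial of the ideals of the fence with edges `w` whose first node has state
`s` and whose last node has state `t`. -/
noncomputable def pathSum : List Bool → Bool → Bool → ℤ[X]
  | [], s, t => if s = t then nodeWeight s else 0
  | b :: w, s, t => nodeWeight s * ∑ u, (if edgeOK b s u then 1 else 0) * pathSum w u t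

/-- The generating polynomial of the ideals of the circular fence obtained by joining the last node
of the fence with edges `w` to its first node by an edge `b`. -/
noncomputable def cycleSum (w : List Bool) (b : Bool) : ℤ[X] :=
  ∑ s, ∑ t, pathSum w s t * (if edgeOK b t s then 1 else 0)

/-- The generating polynomial of all ideals of the fence with edges `w`. -/
noncomputable def fenceSum (w : List Bool) : ℤ[X] := ∑ s, ∑ t, pathSum w s t

section pathSum

variable (w : List Bool) (t : Bool)

theorem pathSum_up_false : pathSum (true :: w) false t = pathSum w false t := by
  simp [pathSum, nodeWeight, edgeOK]

theorem pathSum_up_true :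
    pathSum (true :: w) true t = X * (pathSum w false t + pathSum w true t) := by
  simp [pathSum, nodeWeight, edgeOK, add_comm]

theorem pathSum_down_false :
    pathSum (false :: w) false t = pathSum w false t + pathSum w true t := by
  simp [pathSum, nodeWeight, edgeOK, add_comm]

theorem pathSum_down_true : pathSum (false :: w) true t = X * pathSum w true t := by
  simp [pathSum, nodeWeight, edgeOK]

theorem cycleSum_up : cycleSum w true =
    pathSum w false false + pathSum w false true + pathSum w true true := by
  simp [cycleSum, edgeOK]; ring

theorem cycleSum_down : cycleSum w false =
    pathSum w false false + pathSum w true false + pathSum w true true := by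
  simp [cycleSum, edgeOK]; ring

theorem fenceSum_eq : fenceSum w = pathSum w false false + pathSum w false true +
    (pathSum w true false + pathSum w true true) := by
  simp [fenceSum]; ring

end pathSum

theorem pathSum_append (w : List Bool) (b s t : Bool) : pathSum (w ++ [b]) s t =
    (∑ u, pathSum w s u * (if edgeOK b u t then 1 else 0)) * nodeWeight t := by
  induction w generalizing s with
  | nil => cases s <;> cases t <;> cases b <;> simp [pathSum, nodeWeight, edgeOK]
  | cons c w ih =>
    simp only [List.cons_append, pathSum, ih, Fintype.sum_bool]
    ring

/-! ### Reversal and order duality -/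

/-- Reading the same fence backwards swaps the ends and turns every up edge into a down edge; the
ideals do not change. -/
theorem pathSum_reverse_not (w : List Bool) (s t : Bool) :
    pathSum (w.reverse.map not) s t = pathSum w t s := by
  induction w generalizing t with
  | nil => cases s <;> cases t <;> simp [pathSum]
  | cons b w ih =>
    simp only [List.reverse_cons, List.map_append, List.map_cons, List.map_nil, pathSum_append, ih,
      pathSum, Fintype.sum_bool]
    cases b <;> cases t <;> simp [edgeOK] <;> ring

/-- Entrywise form of S * P(w) = P(w') * Sᵀ, where P(w) is the matrix of `pathSum`, w' is the
negated word and S has rows (1 - X, 1) and (X, X - 1). The matrix S intertwines the up and down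
transfer matrices in both directions, and S * diag(1, X) is symmetric, which is the base case. -/
theorem pathSum_conj (w : List Bool) :
    ((1 - X) * pathSum w false false + pathSum w true false =
      pathSum (w.map not) false false * (1 - X) + pathSum (w.map not) false true) ∧
    ((1 - X) * pathSum w false true + pathSum w true true =
      pathSum (w.map not) false false * X + pathSum (w.map not) false true * (X - 1)) ∧
    (X * pathSum w false false + (X - 1) * pathSum w true false =
      pathSum (w.map not) true false * (1 - X) + pathSum (w.map not) true true) ∧
    (X * pathSum w false true + (X - 1) * pathSum w true true =
      pathSum (w.map not) true false * X + pathSum (w.map not) true true * (X - 1)) := by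
  induction w with
  | nil => simp [pathSum, nodeWeight]; ring
  | cons b w ih =>
    obtain ⟨h1, h2, h3, h4⟩ := ih
    cases b
    · simp only [List.map_cons, Bool.not_false, pathSum_up_false, pathSum_up_true,
        pathSum_down_false, pathSum_down_true]
      refine ⟨?_, ?_, ?_, ?_⟩
      · linear_combination h1
      · linear_combination h2
      · linear_combination X * h1 + X * h3
      · linear_combination X * h2 + X * h4
    · simp only [List.map_cons, Bool.not_true, pathSum_up_false, pathSum_up_true,
        pathSum_down_false, pathSum_down_true]
      refine ⟨?_, ?_, ?_, ?_⟩
      · linear_combination h1 + h3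
      · linear_combination h2 + h4
      · linear_combination X * h3
      · linear_combination X * h4

/-- `cycleSum` is a trace of a product of transfer matrices, so conjugation by the matrix of
`pathSum_conj` leaves it unchanged. The cancelled factor 1 - X + X² is minus the determinant of that
matrix. -/
theorem cycleSum_not (w : List Bool) (b : Bool) :
    cycleSum (w.map not) (!b) = cycleSum w b := by
  obtain ⟨h1, h2, h3, h4⟩ := pathSum_conj w
  have hne : (1 - X + X ^ 2 : ℤ[X]) ≠ 0 := by
    intro h
    simpa using congrArg (eval 0) h
  apply mul_left_cancel₀ hne
  cases b
  · simp only [Bool.not_false, cycleSum_up, cycleSum_down]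
    linear_combination -h1 - X * h3 - X * h2 + (1 - X) * h4
  · simp only [Bool.not_true, cycleSum_up, cycleSum_down]
    linear_combination (X - 1) * h1 - h3 - h2 - X * h4

theorem cycleSum_reverse (w : List Bool) (b : Bool) : cycleSum w.reverse b = cycleSum w b := by
  rw [← cycleSum_not]
  cases b
  · simp only [Bool.not_false, cycleSum_up, cycleSum_down, pathSum_reverse_not]
  · simp only [Bool.not_true, cycleSum_up, cycleSum_down, pathSum_reverse_not]

/-! ### Coefficients at integer indices and palindromicity -/

/-- The coefficients of a polynomial, continued by zero to negative indices. -/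
noncomputable def zcoeff (p : ℤ[X]) (i : ℤ) : ℤ := if 0 ≤ i then p.coeff i.toNat else 0

theorem zcoeff_natCast (p : ℤ[X]) (i : ℕ) : zcoeff p i = p.coeff i := by simp [zcoeff]

theorem zcoeff_zero (i : ℤ) : zcoeff 0 i = 0 := by simp [zcoeff]

theorem zcoeff_one (i : ℤ) : zcoeff 1 i = if i = 0 then 1 else 0 := by
  unfold zcoeff
  split_ifs with h1 h2 h2
  · simp [h2]
  · rw [coeff_one, if_neg (by omega)]
  · omega
  · rfl

theorem zcoeff_add (p r : ℤ[X]) (i : ℤ) : zcoeff (p + r) i = zcoeff p i + zcoeff r i := by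
  unfold zcoeff
  split_ifs <;> simp

theorem zcoeff_X_mul (p : ℤ[X]) (i : ℤ) : zcoeff (X * p) i = zcoeff p (i - 1) := by
  unfold zcoeff
  split_ifs with h1 h2 h2
  · obtain ⟨k, rfl⟩ : ∃ k : ℕ, i = k + 1 := ⟨(i - 1).toNat, by omega⟩
    have e1 : ((k : ℤ) + 1).toNat = k + 1 := by omega
    have e2 : ((k : ℤ) + 1 - 1).toNat = k := by omega
    rw [e1, e2, coeff_X_mul]
  · have : i.toNat = 0 := by omega
    simp [this]
  · omega
  · rfl

theorem zcoeff_X_pow_mul (k : ℕ) (p : ℤ[X]) (i : ℤ) : zcoeff (X ^ k * p) i = zcoeff p (i - k) := by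
  induction k generalizing i with
  | zero => simp
  | succ k ih =>
    rw [pow_succ', mul_assoc, zcoeff_X_mul, ih]
    congr 1
    push_cast
    ring

/-- The complement of an ideal is an ideal of the dual fence, and the two cardinalities add up to
the number of nodes `w.length + 1`. -/
theorem zcoeff_pathSum_not (w : List Bool) (s t : Bool) (i : ℤ) :
    zcoeff (pathSum (w.map not) (!s) (!t)) i = zcoeff (pathSum w s t) (w.length + 1 - i) := by
  induction w generalizing s i with
  | nil =>
    cases s <;> cases t <;> simp [pathSum, nodeWeight, zcoeff_zero]
    · rw [← mul_one X, zcoeff_X_mul, zcoeff_one, zcoeff_one]; congr 1; simp; omega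
    · rw [← mul_one X, zcoeff_X_mul, zcoeff_one, zcoeff_one]; congr 1; simp
  | cons b w ih =>
    have hf := fun i => ih false i
    have ht := fun i => ih true i
    simp only [Bool.not_false, Bool.not_true] at hf ht
    cases b <;> cases s <;>
    simp only [List.map_cons, Bool.not_false, Bool.not_true, pathSum_up_false, pathSum_up_true,
        pathSum_down_false, pathSum_down_true, zcoeff_add, zcoeff_X_mul, hf, ht, List.length_cons]
    · rw [add_comm]; congr 2 <;> push_cast <;> ring
    · congr 1; push_cast; ring
    · congr 1; push_cast; ring
    · rw [add_comm]; congr 2 <;> push_cast <;> ring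

/-- Complementation reverses the coefficients while passing to the dual, and by `cycleSum_not` the
dual has the same polynomial. -/
theorem zcoeff_cycleSum (w : List Bool) (b : Bool) (i : ℤ) :
    zcoeff (cycleSum w b) i = zcoeff (cycleSum w b) (w.length + 1 - i) := by
  rw [← cycleSum_not]
  have h := fun s t => zcoeff_pathSum_not w s t i
  have h1 := h false false
  have h2 := h false true
  have h3 := h true false
  have h4 := h true true
  simp only [Bool.not_false, Bool.not_true] at h1 h2 h3 h4
  conv_rhs => rw [cycleSum_not]
  cases b <;>
  simp only [Bool.not_false, Bool.not_true, cycleSum_up, cycleSum_down, zcoeff_add, h1, h2, h3,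
    h4] <;> ring

/-! ### Heavy halves, interlacing and unimodality -/

/-- The bottom half of `f`, reflected at `K / 2`, dominates the top half. -/
def BottomHeavy (K : ℤ) (f : ℤ → ℤ) : Prop := ∀ i j, i ≤ j → i + j = K → f j ≤ f i

/-- The top half of `f`, reflected at `K / 2`, dominates the bottom half. -/
def TopHeavy (K : ℤ) (f : ℤ → ℤ) : Prop := ∀ i j, i ≤ j → i + j = K → f i ≤ f j

/-- `f` is top interlacing or bottom interlacing with respect to the degree `N`. -/
def Interlacing (N : ℤ) (f : ℤ → ℤ) : Prop :=
  TopHeavy (N - 1) f ∧ BottomHeavy (N + 1) f ∧ (TopHeavy N f ∨ BottomHeavy N f)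

section Interlacing

variable {N K : ℤ} {f : ℤ → ℤ}

/-- Adjacent values are compared through a reflected index: one reflection in N / 2 composed with
one in (N ± 1) / 2 is a shift by one. -/
theorem Interlacing.exists_mode (h : Interlacing N f) :
    ∃ m, N - 1 ≤ 2 * m ∧ 2 * m ≤ N + 1 ∧ (∀ i, i < m → f i ≤ f (i + 1)) ∧
      ∀ i, m ≤ i → f (i + 1) ≤ f i := by
  obtain ⟨h1, h2, h3 | h3⟩ := h
  · refine ⟨(N + 1) / 2, by omega, by omega, fun i hi => ?_, fun i hi => ?_⟩
    · have ha := h3 i (N - i) (by omega) (by omega)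
      rcases le_or_gt (i + 1) (N - i) with h | h
      · exact ha.trans (h2 (i + 1) (N - i) h (by omega))
      · omega
    · have ha := h3 (N - i) i (by omega) (by omega)
      exact (h2 (N - i) (i + 1) (by omega) (by omega)).trans ha
  · refine ⟨N / 2, by omega, by omega, fun i hi => ?_, fun i hi => ?_⟩
    · have ha := h1 i (N - 1 - i) (by omega) (by omega)
      exact ha.trans (h3 (i + 1) (N - 1 - i) (by omega) (by omega))
    · rcases le_or_gt (N - 1 - i) i with h | h
      · have ha := h3 (N - 1 - i) (i + 1) (by omega) (by omega)
        exact ha.trans (h1 (N - 1 - i) i h (by omega))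
      · omega

theorem le_of_forall_le_add_one {m : ℤ} (h : ∀ i, i < m → f i ≤ f (i + 1)) {i j : ℤ}
    (hij : i ≤ j) (hj : j ≤ m) : f i ≤ f j := by
  induction j, hij using Int.leInduction with
  | base => exact le_rfl
  | succ k _ ih => exact (ih (by omega)).trans (h k (by omega))

theorem le_of_forall_add_one_le {m : ℤ} (h : ∀ i, m ≤ i → f (i + 1) ≤ f i) {i j : ℤ}
    (hij : i ≤ j) (hi : m ≤ i) : f j ≤ f i := by
  induction j, hij using Int.leInduction with
  | base => exact le_rfl
  | succ k _ ih => exact (h k (by omega)).trans ih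

/-- Past the mode the sequence decreases. An index before the mode is first reflected in (N + 1) /
2, after which only a decrease from there to `j` is needed. -/
theorem Interlacing.bottomHeavy (h : Interlacing N f) (hK : N + 1 ≤ K) : BottomHeavy K f := by
  obtain ⟨m, _, hm, _, hdn⟩ := h.exists_mode
  intro i j hij hs
  rcases le_or_gt m i with hi | hi
  · exact le_of_forall_add_one_le hdn hij hi
  · exact (le_of_forall_add_one_le hdn (i := N + 1 - i) (by omega) (by omega)).trans
      (h.2.1 i (N + 1 - i) (by omega) (by omega))

theorem Interlacing.topHeavy (h : Interlacing N f) (hK : K ≤ N - 1) : TopHeavy K f := by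
  obtain ⟨m, hm, _, hup, _⟩ := h.exists_mode
  intro i j hij hs
  rcases le_or_gt j m with hj | hj
  · exact le_of_forall_le_add_one hup hij hj
  · exact (le_of_forall_le_add_one hup (j := N - 1 - j) (by omega) (by omega)).trans
      (h.1 (N - 1 - j) j (by omega) (by omega))

theorem Interlacing.topHeavy_or (h : Interlacing N f) (K : ℤ) :
    TopHeavy K f ∨ BottomHeavy K f := by
  rcases lt_trichotomy K N with hK | rfl | hK
  · exact Or.inl (h.topHeavy (by omega))
  · exact h.2.2
  · exact Or.inr (h.bottomHeavy (by omega))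

end Interlacing

theorem TopHeavy.X_pow_mul {K : ℤ} {p : ℤ[X]} {k : ℕ} (h : TopHeavy (K - 2 * k) (zcoeff p)) :
    TopHeavy K (zcoeff (X ^ k * p)) := by
  intro i j hij hs
  rw [zcoeff_X_pow_mul, zcoeff_X_pow_mul]
  exact h _ _ (by omega) (by omega)

theorem BottomHeavy.X_pow_mul {K : ℤ} {p : ℤ[X]} {k : ℕ}
    (h : BottomHeavy (K - 2 * k) (zcoeff p)) : BottomHeavy K (zcoeff (X ^ k * p)) := by
  intro i j hij hs
  rw [zcoeff_X_pow_mul, zcoeff_X_pow_mul]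
  exact h _ _ (by omega) (by omega)

theorem topHeavy_zero (K : ℤ) : TopHeavy K (zcoeff 0) := by
  intro i j _ _
  simp [zcoeff_zero]

/-! ### Peeling forced nodes off the ends of a fence -/

/-- `p` is the rank polynomial of a possibly empty fence with `N` nodes. -/
def IsFencePoly (N : ℕ) (p : ℤ[X]) : Prop :=
  (N = 0 ∧ p = 1) ∨ ∃ w : List Bool, w.length + 1 = N ∧ p = fenceSum w

section peel

/-- A first node in the ideal forces the initial run of down edges into it. Either this exhausts the
fence, or `k` nodes are forced and the fence `x` beyond the first up edge has a free first node. -/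
theorem pathSum_true_left (w : List Bool) :
    (∀ t, pathSum w true t = if t then X ^ (w.length + 1) else 0) ∨
    ∃ (k : ℕ) (x : List Bool), 1 ≤ k ∧ w.length + 1 = k + (x.length + 1) ∧
      ∀ t, pathSum w true t = X ^ k * (pathSum x false t + pathSum x true t) := by
  induction w with
  | nil => left; intro t; cases t <;> simp [pathSum, nodeWeight]
  | cons b w ih =>
    cases b
    · rcases ih with h | ⟨k, x, hk, hl, h⟩
      · left
        intro t
        cases t <;> simp [pathSum_down_true, h, pow_succ']
      · right
        refine ⟨k + 1, x, by omega, by simp only [List.length_cons]; omega, fun t => ?_⟩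
        rw [pathSum_down_true, h]
        ring
    · right
      exact ⟨1, w, le_rfl, by simp only [List.length_cons]; omega,
        fun t => by rw [pathSum_up_true, pow_one]⟩

theorem pathSum_false_left (w : List Bool) :
    (∀ t, pathSum w false t = if t then 0 else 1) ∨
    ∃ (k : ℕ) (x : List Bool), 1 ≤ k ∧ w.length + 1 = k + (x.length + 1) ∧
      ∀ t, pathSum w false t = pathSum x false t + pathSum x true t := by
  induction w with
  | nil => left; intro t; cases t <;> simp [pathSum, nodeWeight]
  | cons b w ih =>
    cases b
    · right
      exact ⟨1, w, le_rfl, by simp only [List.length_cons]; omega,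
        fun t => by rw [pathSum_down_false]⟩
    · rcases ih with h | ⟨k, x, hk, hl, h⟩
      · left
        intro t
        cases t <;> simp [pathSum_up_false, h]
      · right
        refine ⟨k + 1, x, by omega, by simp only [List.length_cons]; omega, fun t => ?_⟩
        rw [pathSum_up_false, h]

theorem pathSum_false_right (w : List Bool) :
    (∀ s, pathSum w s false = if s then 0 else 1) ∨
    ∃ (k : ℕ) (x : List Bool), 1 ≤ k ∧ w.length + 1 = k + (x.length + 1) ∧
      ∀ s, pathSum w s false = pathSum x s false + pathSum x s true := by
  rcases pathSum_false_left (w.reverse.map not) with h | ⟨k, x, hk, hl, h⟩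
  · left
    intro s
    have hs := h s
    rw [pathSum_reverse_not] at hs
    simpa using hs
  · right
    refine ⟨k, x.reverse.map not, hk, by simpa using hl, fun s => ?_⟩
    rw [pathSum_reverse_not, pathSum_reverse_not, ← h, pathSum_reverse_not]

theorem fenceSum_eq_left (w : List Bool) : fenceSum w = (pathSum w false false +
    pathSum w true false) + (pathSum w false true + pathSum w true true) := by
  rw [fenceSum_eq]; ring

theorem exists_row_true (w : List Bool) : ∃ (k M : ℕ) (p : ℤ[X]), 1 ≤ k ∧ w.length + 1 = k + M ∧
    IsFencePoly M p ∧ pathSum w true false + pathSum w true true = X ^ k * p := by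
  rcases pathSum_true_left w with h | ⟨k, x, hk, hl, h⟩
  · exact ⟨w.length + 1, 0, 1, by omega, rfl, Or.inl ⟨rfl, rfl⟩, by simp [h]⟩
  · refine ⟨k, _, fenceSum x, hk, hl, Or.inr ⟨x, rfl, rfl⟩, ?_⟩
    rw [h, h, fenceSum_eq_left]; ring

theorem exists_col_true (w : List Bool) : ∃ (k M : ℕ) (p : ℤ[X]), 1 ≤ k ∧ w.length + 1 = k + M ∧
    IsFencePoly M p ∧ pathSum w false true + pathSum w true true = X ^ k * p := by
  obtain ⟨k, M, p, hk, hl, hp, h⟩ := exists_row_true (w.reverse.map not)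
  refine ⟨k, M, p, hk, by simpa using hl, hp, ?_⟩
  rw [← h, pathSum_reverse_not, pathSum_reverse_not]

theorem exists_col_false (w : List Bool) : ∃ (k M : ℕ) (p : ℤ[X]), 1 ≤ k ∧
    w.length + 1 = k + M ∧ IsFencePoly M p ∧
    pathSum w false false + pathSum w true false = p := by
  rcases pathSum_false_right w with h | ⟨k, x, hk, hl, h⟩
  · exact ⟨w.length + 1, 0, 1, by omega, rfl, Or.inl ⟨rfl, rfl⟩, by simp [h]⟩
  · refine ⟨k, _, fenceSum x, hk, hl, Or.inr ⟨x, rfl, rfl⟩, ?_⟩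
    rw [h, h, fenceSum_eq]

theorem exists_true_true (w : List Bool) : ∃ (k M : ℕ) (p : ℤ[X]), 1 ≤ k ∧ w.length + 1 = k + M ∧
    IsFencePoly M p ∧ pathSum w true true = X ^ k * p := by
  rcases pathSum_true_left w with h | ⟨k, x, hk, hl, h⟩
  · exact ⟨w.length + 1, 0, 1, by omega, rfl, Or.inl ⟨rfl, rfl⟩, by simp [h]⟩
  · obtain ⟨k', M, p, hk', hl', hp, h'⟩ := exists_col_true x
    refine ⟨k + k', M, p, by omega, by omega, hp, ?_⟩
    rw [h, h']; ring

theorem exists_false_false (w : List Bool) : ∃ (k M : ℕ) (p : ℤ[X]), 1 ≤ k ∧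
    w.length + 1 = k + M ∧ IsFencePoly M p ∧ pathSum w false false = p := by
  rcases pathSum_false_left w with h | ⟨k, x, hk, hl, h⟩
  · exact ⟨w.length + 1, 0, 1, by omega, rfl, Or.inl ⟨rfl, rfl⟩, by simp [h]⟩
  · obtain ⟨k', M, p, hk', hl', hp, h'⟩ := exists_col_false x
    exact ⟨k + k', M, p, by omega, by omega, hp, by rw [h, h']⟩

/-- Nodes forced in on the left contribute the power of X; nodes forced out on the right contribute
nothing, so `k + M` may fall short of the number of nodes. The sum vanishes when the last node is
forced in. -/
theorem exists_true_false (w : List Bool) : pathSum w true false = 0 ∨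
    ∃ (k M : ℕ) (p : ℤ[X]), 1 ≤ k ∧ k + M ≤ w.length + 1 ∧
    IsFencePoly M p ∧ pathSum w true false = X ^ k * p := by
  rcases pathSum_true_left w with h | ⟨k, x, hk, hl, h⟩
  · left; simp [h]
  · right
    obtain ⟨k', M, p, hk', hl', hp, h'⟩ := exists_col_false x
    exact ⟨k, M, p, by omega, by omega, hp, by rw [h, h']⟩

end peel

/-! ### Interlacing of fence polynomials -/

/-- Rank polynomials of fences are top or bottom interlacing. -/
theorem IsFencePoly.interlacing {N : ℕ} {p : ℤ[X]} (h : IsFencePoly N p) :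
    Interlacing N (zcoeff p) := by
  induction N using Nat.strong_induction_on generalizing p with
  | _ N ih =>
  rcases h with ⟨rfl, rfl⟩ | ⟨w, rfl, rfl⟩
  · refine ⟨?_, ?_, Or.inl ?_⟩ <;> intro i j hij hs <;> push_cast at hs <;>
      simp only [zcoeff_one] <;> split_ifs <;> omega
  · have hF : ∀ i, zcoeff (fenceSum w) i = zcoeff (pathSum w false false) i +
        zcoeff (pathSum w false true) i + (zcoeff (pathSum w true false) i +
        zcoeff (pathSum w true true) i) := fun i => by simp only [fenceSum_eq, zcoeff_add]
    have hup : ∀ i, zcoeff (pathSum (true :: w) false false) i =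
        zcoeff (pathSum w false false) i := fun i => by rw [pathSum_up_false]
    refine ⟨?_, ?_, ?_⟩
    -- Closing up through a new minimal node gives the palindromic polynomial X * F + P, where P
    -- counts ideals with both ends out. P is bottom heavy, so X * F is top heavy about the same
    -- axis; the extra X is the index shift by one.
    · obtain ⟨k, M, p, hk, hl, hp, h⟩ := exists_false_false w
      have hb := (ih M (by omega) hp).bottomHeavy (K := w.length + 1 + 1) (by omega)
      intro i j hij hs
      have h1 := zcoeff_cycleSum (true :: w) false (i + 1)
      have h2 := hb (i + 1) (j + 1) (by omega) (by push_cast at hs; omega)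
      have e : ((true :: w).length : ℤ) + 1 - (i + 1) = j + 1 := by
        push_cast [List.length_cons] at hs ⊢; omega
      rw [e] at h1
      simp only [cycleSum_down, pathSum_up_false, pathSum_up_true, zcoeff_add, zcoeff_X_mul,
        add_sub_cancel_right] at h1
      rw [← h] at h2
      have := hF i
      have := hF j
      linarith
    -- Closing up through a new maximal node gives F + X * P, with P counting ideals with both ends
    -- in. Here X * P is top heavy, so F is bottom heavy.
    · obtain ⟨k, M, p, hk, hl, hp, h⟩ := exists_true_true w
      have hb := ((ih M (by omega) hp).topHeavy (K := w.length - 2 * k) (by omega)).X_pow_mul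
      rw [← h] at hb
      intro i j hij hs
      have h1 := zcoeff_cycleSum (false :: w) true i
      have h2 := hb (i - 1) (j - 1) (by omega) (by push_cast at hs; omega)
      have e : ((false :: w).length : ℤ) + 1 - i = j := by
        push_cast [List.length_cons] at hs ⊢; omega
      rw [e] at h1
      simp only [cycleSum_up, pathSum_down_false, pathSum_down_true, zcoeff_add, zcoeff_X_mul]
        at h1
      have := hF i
      have := hF j
      linarith
    -- Joining the ends directly by an up edge excludes exactly the ideals containing the first node
    -- but not the last. Hence F inherits the heavy half of that excluded part.
    · have key : TopHeavy (w.length + 1) (zcoeff (pathSum w true false)) ∨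
          BottomHeavy (w.length + 1) (zcoeff (pathSum w true false)) := by
        rcases exists_true_false w with h | ⟨k, M, p, hk, hl, hp, h⟩
        · rw [h]; exact Or.inl (topHeavy_zero _)
        · rw [h]
          exact ((ih M (by omega) hp).topHeavy_or _).imp TopHeavy.X_pow_mul BottomHeavy.X_pow_mul
      have hsym : ∀ i j : ℤ, i + j = (w.length + 1 : ℕ) →
          zcoeff (fenceSum w) i - zcoeff (pathSum w true false) i =
          zcoeff (fenceSum w) j - zcoeff (pathSum w true false) j := by
        intro i j hs
        have h1 := zcoeff_cycleSum w true i
        have e : (w.length : ℤ) + 1 - i = j := by push_cast at hs; omega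
        rw [e] at h1
        simp only [cycleSum_up, zcoeff_add] at h1
        have := hF i
        have := hF j
        linarith
      refine key.imp (fun h i j hij hs => ?_) (fun h i j hij hs => ?_)
      · have := hsym i j hs
        have := h i j hij (by push_cast at hs; omega)
        linarith
      · have := hsym i j hs
        have := h i j hij (by push_cast at hs; omega)
        linarith

theorem isFencePoly_fenceSum (w : List Bool) : IsFencePoly (w.length + 1) (fenceSum w) :=
  Or.inr ⟨w, rfl, rfl⟩

/-- An up edge from last to first node removes precisely the state pair (in, out) and leaves a
palindromic polynomial. -/
theorem topHeavy_fenceSum_of_true_false {w : List Bool}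
    (h : TopHeavy (w.length + 1) (zcoeff (pathSum w true false))) :
    TopHeavy (w.length + 1) (zcoeff (fenceSum w)) := by
  intro i j hij hs
  have h1 := zcoeff_cycleSum w true i
  have e : (w.length : ℤ) + 1 - i = j := by omega
  rw [e] at h1
  simp only [cycleSum_up, zcoeff_add] at h1
  have := h i j hij hs
  simp only [fenceSum_eq, zcoeff_add]
  linarith

theorem topHeavy_fenceSum_of_false_true {w : List Bool}
    (h : TopHeavy (w.length + 1) (zcoeff (pathSum w false true))) :
    TopHeavy (w.length + 1) (zcoeff (fenceSum w)) := by
  intro i j hij hs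
  have h1 := zcoeff_cycleSum w false i
  have e : (w.length : ℤ) + 1 - i = j := by omega
  rw [e] at h1
  simp only [cycleSum_down, zcoeff_add] at h1
  have := h i j hij hs
  simp only [fenceSum_eq, zcoeff_add]
  linarith

/-! ### Deleting a maximal node -/

theorem cycleSum_eq_fenceSum_add (w : List Bool) :
    cycleSum (false :: w) true = fenceSum w + X * pathSum w true true := by
  simp only [cycleSum_up, pathSum_down_false, pathSum_down_true, fenceSum_eq]
  ring

/-- The coefficients of the rank polynomial of a circular fence increase up to the middle if
deleting a maximal node leaves a fence with top heavy rank polynomial. -/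
theorem zcoeff_cycleSum_le_of_topHeavy {w : List Bool}
    (h : TopHeavy (w.length + 1) (zcoeff (fenceSum w))) (i : ℤ) (hi : 2 * (i + 1) ≤ w.length + 2) :
    zcoeff (cycleSum (false :: w) true) i ≤ zcoeff (cycleSum (false :: w) true) (i + 1) := by
  have hB := (isFencePoly_fenceSum w).interlacing.2.1
  -- The reflections in (N + 1) / 2 and N / 2 compose to a shift by one; bottom heaviness at N + 1
  -- holds for every fence, so the assumption is needed only at N.
  have hF : zcoeff (fenceSum w) i ≤ zcoeff (fenceSum w) (i + 1) :=
    (h i (w.length + 1 - i) (by omega) (by omega)).trans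
      (hB (i + 1) (w.length + 1 - i) (by omega) (by push_cast; omega))
  obtain ⟨k, M, p, hk, hl, hp, hq⟩ := exists_true_true w
  -- The whole sum is palindromic about this axis and the summand F is bottom heavy there, so the
  -- other summand is top heavy.
  have hT : TopHeavy (w.length + 2) (zcoeff (X * pathSum w true true)) := by
    intro i j hij hs
    have h1 := zcoeff_cycleSum (false :: w) true i
    have e : ((false :: w).length : ℤ) + 1 - i = j := by
      push_cast [List.length_cons]; omega
    rw [e, cycleSum_eq_fenceSum_add, zcoeff_add, zcoeff_add] at h1
    have := hB i j hij (by push_cast; omega)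
    linarith
  have hU : zcoeff (X * pathSum w true true) i ≤ zcoeff (X * pathSum w true true) (i + 1) := by
    obtain ⟨m, _, _, hup, hdn⟩ := hp.interlacing.exists_mode
    have e : ∀ i, zcoeff (X * pathSum w true true) i = zcoeff p (i - (k + 1)) := fun i => by
      rw [hq, zcoeff_X_mul, zcoeff_X_pow_mul]; congr 1; ring
    rcases lt_or_ge (i - (k + 1)) m with hm | hm
    · have := hup _ hm
      rw [e, e]
      convert this using 2; ring
    -- Past the mode, reflection does not lower the value, and the reflected index is at least `i +
    -- 1`, so the value there is at most that at `i + 1`: the sequence can only be constant between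
    -- these indices.
    · refine (hT i (w.length + 2 - i) (by omega) (by omega)).trans ?_
      rw [e, e]
      exact le_of_forall_add_one_le hdn (by omega) (by omega)
  rw [cycleSum_eq_fenceSum_add, zcoeff_add, zcoeff_add]
  exact add_le_add hF hU

/-- With the first node in and the last out, the edges at the two ends impose no condition on the
last inner node and force the first inner node in. At least two nodes are thus forced in against one
forced out, which moves the polynomial right of the middle. -/
theorem topHeavy_fenceSum_down_append_up (w : List Bool) :
    TopHeavy ((false :: (w ++ [true])).length + 1)
      (zcoeff (fenceSum (false :: (w ++ [true])))) := by
  apply topHeavy_fenceSum_of_true_false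
  obtain ⟨k, M, p, hk, hl, hp, h⟩ := exists_row_true w
  have e : pathSum (false :: (w ++ [true])) true false = X ^ (k + 1) * p := by
    rw [pathSum_down_true, pathSum_append, pow_succ', mul_assoc, ← h]
    simp [nodeWeight, edgeOK, add_comm]
  rw [e]
  apply TopHeavy.X_pow_mul
  apply hp.interlacing.topHeavy
  simp only [List.length_cons, List.length_append, List.length_nil]
  push_cast
  omega

theorem pathSum_replicate_up_append (l : ℕ) (y : List Bool) (t : Bool) :
    pathSum (List.replicate l true ++ y) false t = pathSum y false t := by
  induction l with
  | zero => simp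
  | succ l ih => rw [List.replicate_succ, List.cons_append, pathSum_up_false, ih]

theorem pathSum_append_replicate_up (k : ℕ) (y : List Bool) (s : Bool) :
    pathSum (y ++ List.replicate k true) s true = X ^ k * pathSum y s true := by
  induction k with
  | zero => simp
  | succ k ih =>
    rw [List.replicate_succ', ← List.append_assoc, pathSum_append]
    simp only [Fintype.sum_bool, ih]
    simp [edgeOK, nodeWeight]
    ring

/-- With the first node out and the last in, the initial up run forces `l + 1` nodes out, while the
final up run forces at least `k + 1` nodes in. Since `l < k`, the excluded part is centred right of
the middle. -/
theorem topHeavy_fenceSum_of_lt (l k : ℕ) (hlk : l < k) (w : List Bool) :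
    TopHeavy ((List.replicate l true ++ false :: (w ++ List.replicate k true)).length + 1)
      (zcoeff (fenceSum (List.replicate l true ++ false :: (w ++ List.replicate k true)))) := by
  apply topHeavy_fenceSum_of_false_true
  obtain ⟨j, M, p, hj, hl, hp, h⟩ := exists_col_true w
  have e : pathSum (List.replicate l true ++ false :: (w ++ List.replicate k true)) false true =
      X ^ (k + j) * p := by
    rw [pathSum_replicate_up_append, pathSum_down_false, pathSum_append_replicate_up,
      pathSum_append_replicate_up, pow_add, mul_assoc, ← h]
    ring
  rw [e]
  apply TopHeavy.X_pow_mul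
  apply hp.interlacing.topHeavy
  simp only [List.length_cons, List.length_append, List.length_replicate]
  push_cast
  omega

/-! ### Cyclic words with a suitable peak -/

/-- The coefficients of a polynomial increase up to the middle of degree `n / 2`. -/
def IncreasingToMiddle (n : ℕ) (p : ℤ[X]) : Prop :=
  ∀ i : ℤ, 2 * (i + 1) ≤ n → zcoeff p i ≤ zcoeff p (i + 1)

section words

variable {n : ℕ} {f : ℕ → Bool}

theorem map_range_eq_replicate {b : Bool} (m s : ℕ) (h : ∀ j < m, f (s + j) = b) :
    (List.range m).map (fun j => f (s + j)) = List.replicate m b := by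
  rw [List.eq_replicate_iff]
  refine ⟨by simp, fun x hx => ?_⟩
  obtain ⟨j, hj, rfl⟩ := List.mem_map.1 hx
  exact h j (List.mem_range.1 hj)

theorem increasingToMiddle_of_two_two (hn : 3 ≤ n) (h0 : f 0 = false) (h1 : f 1 = false)
    (h2 : f (n - 1) = true) (h3 : f n = true) :
    IncreasingToMiddle (n + 1) (cycleSum ((List.range n).map f) (f n)) := by
  obtain ⟨m, rfl⟩ : ∃ m, n = 1 + (1 + (m + 1)) := ⟨n - 3, by omega⟩
  have e : (List.range (1 + (1 + (m + 1)))).map f =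
      false :: false :: ((List.range m).map (fun j => f (1 + (1 + j))) ++ [true]) := by
    have h2' : f (1 + (1 + m)) = true := by rw [← h2]; congr 1
    simp only [List.range_add, List.map_append, List.map_map]
    simp [h0, h1, h2', Function.comp_def]
  rw [e, h3]
  intro i hi
  apply zcoeff_cycleSum_le_of_topHeavy (topHeavy_fenceSum_down_append_up _)
  simp only [List.length_cons, List.length_append, List.length_nil, List.length_map,
    List.length_range]
  push_cast at hi ⊢
  omega

theorem increasingToMiddle_of_replicate (k l m : ℕ) (hlk : l < k) (w : List Bool)
    (hw : w = false :: (List.replicate l true ++ false ::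
      ((List.range m).map f ++ List.replicate k true))) :
    IncreasingToMiddle (w.length + 1) (cycleSum w true) := by
  rw [hw]
  intro i hi
  apply zcoeff_cycleSum_le_of_topHeavy (topHeavy_fenceSum_of_lt l k hlk _)
  simp only [List.length_cons] at hi ⊢
  push_cast at hi ⊢
  omega

/-- The case of a word `D U ^ l D ⋯ U ^ (k + 1)`, read cyclically, with `l < k`. -/
theorem increasingToMiddle_of_peak (k l : ℕ) (hlk : l < k) (hn : l + 2 + k ≤ n)
    (h0 : f 0 = false) (h1 : ∀ j < l, f (1 + j) = true) (h2 : f (1 + l) = false)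
    (h3 : ∀ j < k + 1, f (n - k + j) = true) :
    IncreasingToMiddle (n + 1) (cycleSum ((List.range n).map f) (f n)) := by
  obtain ⟨m, rfl⟩ : ∃ m, n = 1 + (l + (1 + (m + k))) := ⟨n - (l + 2 + k), by omega⟩
  have e : (List.range (1 + (l + (1 + (m + k))))).map f = false :: (List.replicate l true ++
      false :: ((List.range m).map (fun j => f (1 + (l + (1 + j)))) ++
        List.replicate k true)) := by
    have h3' : ∀ j < k, f (1 + (l + (1 + m)) + j) = true := fun j hj => by
      rw [← h3 j (by omega)]; congr 1; omega
    rw [← map_range_eq_replicate l 1 h1, ← map_range_eq_replicate k _ h3']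
    simp only [List.range_add, List.map_append, List.map_map]
    simp [h0, h2, Function.comp_def, add_assoc]
  have h4 : f (1 + (l + (1 + (m + k)))) = true := by
    rw [← h3 k (by omega)]; congr 1; omega
  rw [h4]
  have := increasingToMiddle_of_replicate k l m hlk _ e
  simpa using this

/-- The case of a word `U ^ k ⋯ D U ^ l D U`, read cyclically, with `l < k`. -/
theorem increasingToMiddle_of_peak_reverse (k l : ℕ) (hlk : l < k) (hn : l + 2 + k ≤ n)
    (h0 : ∀ j < k, f j = true) (h1 : f (n - 2 - l) = false)
    (h2 : ∀ j < l, f (n - 1 - l + j) = true) (h3 : f (n - 1) = false) (h4 : f n = true) :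
    IncreasingToMiddle (n + 1) (cycleSum ((List.range n).map f) (f n)) := by
  obtain ⟨m, rfl⟩ : ∃ m, n = k + (m + (1 + (l + 1))) := ⟨n - (l + 2 + k), by omega⟩
  have e : ((List.range (k + (m + (1 + (l + 1))))).map f).reverse =
      false :: (List.replicate l true ++ false ::
      ((List.range m).map (fun j => f (k + (m - 1 - j))) ++ List.replicate k true)) := by
    have h0' : ∀ j < k, f (0 + j) = true := fun j hj => by rw [zero_add]; exact h0 j hj
    have h1' : f (k + m) = false := by rw [← h1]; congr 1; omega
    have h2' : ∀ j < l, f (k + (m + 1) + j) = true := fun j hj => by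
      rw [← h2 j hj]; congr 1; omega
    have h3' : f (k + (m + (1 + l))) = false := by rw [← h3]; congr 1
    rw [← List.reverse_inj, List.reverse_reverse]
    have er : ((List.range m).map (fun j => f (k + (m - 1 - j)))).reverse =
        (List.range m).map (fun j => f (k + j)) := by
      rw [← List.map_reverse]
      apply List.ext_getElem
      · simp
      · intro i hi1 hi2
        simp only [List.length_map, List.length_range] at hi2
        simp only [List.getElem_map, List.getElem_reverse, List.getElem_range, List.length_range]
        congr 2
        omega
    simp only [List.reverse_cons, List.reverse_append, List.reverse_replicate, er]
    rw [← map_range_eq_replicate k 0 h0', ← map_range_eq_replicate l _ h2']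
    simp only [List.range_add, List.map_append, List.map_map]
    simp [h1', h3', Function.comp_def, add_assoc]
  -- Reversing the word without negating its letters preserves `cycleSum` and reduces to the same
  -- linear pattern.
  rw [h4, ← cycleSum_reverse]
  have := increasingToMiddle_of_replicate k l m hlk _ e
  simpa using this

end words

/-! ### From sums over ideals to transfer matrices -/

/-- Expansion of the matrix product over all state sequences, which lets `pathSum` be compared with
sums over subsets of nodes. -/
theorem pathSum_map_range (m : ℕ) (f : ℕ → Bool) (a b : Bool) :
    pathSum ((List.range m).map f) a b = ∑ s : Fin (m + 1) → Bool,
      (if s 0 = a then 1 else 0) * (if s (Fin.last m) = b then 1 else 0) *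
      (∏ j : Fin m, if edgeOK (f j) (s j.castSucc) (s j.succ) then 1 else 0) *
      ∏ j, nodeWeight (s j) := by
  induction m generalizing f a with
  | zero =>
    rw [← (Equiv.funUnique (Fin 1) Bool).symm.sum_comp]
    cases a <;> cases b <;> simp [pathSum]
  | succ m ih =>
    rw [← (Fin.consEquiv fun _ => Bool).sum_comp, Fintype.sum_prod_type]
    simp only [List.range_succ_eq_map, List.map_cons, List.map_map, pathSum, ih,
      Fintype.sum_bool, Fin.consEquiv_apply, Fin.cons_zero, ← Fin.succ_last, Fin.cons_succ]
    simp only [Fin.prod_univ_succ, Fin.castSucc_zero, Fin.cons_zero, Fin.cons_succ,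
      Fin.castSucc_succ, Fin.val_succ, Fin.val_zero]
    rw [← Finset.sum_add_distrib]
    simp only [Finset.mul_sum, ← Finset.sum_add_distrib]
    refine Finset.sum_congr rfl fun s _ => ?_
    cases a <;> cases h : s 0 <;> simp [edgeOK] <;> ring_nf

section rankPolynomial

variable {P : Type*} [PartialOrder P] [Fintype P]

theorem natDegree_rankPolynomial : (rankPolynomial P).natDegree = Fintype.card P := by
  classical
  apply natDegree_eq_of_le_of_coeff_ne_zero
  · refine natDegree_sum_le_of_forall_le _ _ fun I _ => ?_
    rw [natDegree_X_pow]
    exact Finset.card_le_univ I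
  · rw [rankPolynomial, finsetSum_coeff]
    intro h
    have := (Finset.sum_eq_zero_iff.1 h) Finset.univ (by simpa using isLowerSet_univ)
    simp at this

open Classical in
theorem rankPolynomial_ne {T : P} (hT : IsMax T) [Fintype {x : P // x ≠ T}] :
    rankPolynomial {x : P // x ≠ T} =
      ∑ I ∈ (Finset.univ : Finset (Finset P)).filter
      (fun I : Finset P => IsLowerSet (I : Set P) ∧ T ∉ I), X ^ I.card := by
  rw [rankPolynomial]
  refine Finset.sum_bij' (fun J _ => J.map (Function.Embedding.subtype _))
    (fun I _ => I.subtype (· ≠ T)) ?_ ?_ ?_ ?_ ?_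
  · intro J hJ
    simp only [Finset.mem_filter, Finset.mem_univ, true_and] at hJ ⊢
    refine ⟨fun y x hxy hy => ?_, by simp⟩
    simp only [Finset.coe_map, Set.mem_image, Finset.mem_coe] at hy ⊢
    obtain ⟨y', hy', rfl⟩ := hy
    have hx : x ≠ T := by
      rintro rfl
      exact y'.2 (hT.eq_of_le hxy).symm
    exact ⟨⟨x, hx⟩, hJ (show (⟨x, hx⟩ : {x : P // x ≠ T}) ≤ y' from hxy) hy', rfl⟩
  · intro I hI
    simp only [Finset.mem_filter, Finset.mem_univ, true_and] at hI ⊢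
    intro y x hxy hy
    simp only [Finset.mem_coe, Finset.mem_subtype] at hy ⊢
    exact hI.1 hxy hy
  · intro J _
    ext x
    simpa using fun _ => x.2
  · intro I hI
    simp only [Finset.mem_filter, Finset.mem_univ, true_and] at hI
    rw [Finset.subtype_map, Finset.filter_true_of_mem]
    rintro x hx rfl
    exact hI.2 hx
  · intro J _
    rw [Finset.card_map]

open Classical in
theorem rankPolynomial_eq_add (T : P) : rankPolynomial P =
    (∑ I ∈ (Finset.univ : Finset (Finset P)).filter
      (fun I : Finset P => IsLowerSet (I : Set P) ∧ T ∉ I), X ^ I.card) +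
    ∑ I ∈ (Finset.univ : Finset (Finset P)).filter
      (fun I : Finset P => IsLowerSet (I : Set P) ∧ T ∈ I), X ^ I.card := by
  rw [rankPolynomial, ← Finset.filter_filter, ← Finset.filter_filter, add_comm,
    Finset.sum_filter_add_sum_filter_not]

end rankPolynomial

/-- The direction of the edge from node `k` (taken modulo `n`) to the next node: `true` for up. -/
def edgeLetter {n : ℕ} (c : Composition (n + 1)) (k : ℕ) : Bool :=
  decide (Even (c.index ⟨k % (n + 1), Nat.mod_lt _ n.succ_pos⟩ : ℕ))

theorem cyclicSucc_eq_add_one {n : ℕ} (j : Fin (n + 1)) : cyclicSucc j = j + 1 := by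
  ext
  simp [cyclicSucc, Fin.val_add]

namespace CircularFence

variable {n : ℕ} {c : Composition (n + 1)} {hc : Even c.length}

theorem isLowerSet_iff (I : Finset (Fin (n + 1))) :
    @IsLowerSet (CircularFence c hc) _ (I : Set (Fin (n + 1))) ↔
      ∀ x y : Fin (n + 1), Step c x y → y ∈ I → x ∈ I := by
  constructor
  · intro h x y hxy hy
    exact h (a := y) (b := x) (Relation.ReflTransGen.single hxy) hy
  · intro h y x hxy hy
    have hxy' : Relation.ReflTransGen (Step c) x y := hxy
    clear hxy
    induction hxy' using Relation.ReflTransGen.head_induction_on with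
    | refl => exact hy
    | head h1 _ ih => exact h _ _ h1 ih

theorem edgeLetter_val (x : Fin (n + 1)) : edgeLetter c x = decide (Even (c.index x : ℕ)) := by
  simp only [edgeLetter, Nat.mod_eq_of_lt x.2, Fin.eta]

theorem isLowerSet_iff_edgeOK (I : Finset (Fin (n + 1))) :
    @IsLowerSet (CircularFence c hc) _ (I : Set (Fin (n + 1))) ↔
      ∀ x : Fin (n + 1), edgeOK (edgeLetter c x) (decide (x ∈ I)) (decide (x + 1 ∈ I)) = true := by
  rw [isLowerSet_iff]
  constructor
  · intro h x
    rw [edgeLetter_val]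
    by_cases hx : Even (c.index x : ℕ)
    · have := h x (x + 1) (Or.inl ⟨hx, (cyclicSucc_eq_add_one x).symm⟩)
      by_cases h1 : x ∈ I
      · simp [hx, h1, edgeOK]
      · have h2 : x + 1 ∉ I := fun h2 => h1 (this h2)
        simp [hx, h1, h2, edgeOK]
    · have := h (x + 1) x (Or.inr ⟨Nat.not_even_iff_odd.1 hx, (cyclicSucc_eq_add_one x).symm⟩)
      by_cases h1 : x ∈ I
      · simp [hx, h1, this h1, edgeOK]
      · simp [hx, h1, edgeOK]
  · rintro h x y (⟨hx, rfl⟩ | ⟨hy, rfl⟩) hm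
    · have := h x
      rw [edgeLetter_val] at this
      rw [cyclicSucc_eq_add_one] at hm
      by_contra hn
      simp [hx, hn, hm, edgeOK] at this
    · have := h y
      rw [edgeLetter_val] at this
      rw [cyclicSucc_eq_add_one]
      by_contra hn
      simp [Nat.not_even_iff_odd.2 hy, hm, hn, edgeOK] at this

/-- Node states, numbered from the node `T` on, as sets of nodes. -/
def statesEquiv (T : Fin (n + 1)) : (Fin (n + 1) → Bool) ≃ Finset (Fin (n + 1)) where
  toFun s := Finset.univ.filter fun x => s (x - T) = true
  invFun I j := decide (T + j ∈ I)
  left_inv s := by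
    funext j
    simp
  right_inv I := by
    ext x
    simp

theorem card_statesEquiv (T : Fin (n + 1)) (s : Fin (n + 1) → Bool) :
    (X ^ (statesEquiv T s).card : ℤ[X]) = ∏ j, nodeWeight (s j) := by
  rw [← (Equiv.subRight T).prod_comp]
  simp only [nodeWeight, Finset.prod_ite, Finset.prod_const_one, mul_one, Finset.prod_const]
  rfl

theorem edgeLetter_add (T j : Fin (n + 1)) :
    edgeLetter c ((T + j : Fin (n + 1)) : ℕ) = edgeLetter c ((T : ℕ) + j) := by
  simp [edgeLetter, Fin.val_add]

theorem isLowerSet_statesEquiv (T : Fin (n + 1)) (s : Fin (n + 1) → Bool) :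
    @IsLowerSet (CircularFence c hc) _ (statesEquiv T s : Set (Fin (n + 1))) ↔
      ∀ j : Fin (n + 1), edgeOK (edgeLetter c ((T : ℕ) + j)) (s j) (s (j + 1)) = true := by
  rw [isLowerSet_iff_edgeOK, ← (Equiv.addLeft T).forall_congr_right]
  refine forall_congr' fun j => ?_
  have h1 : decide (T + j ∈ statesEquiv T s) = s j := by simp [statesEquiv]
  have h2 : decide (T + j + 1 ∈ statesEquiv T s) = s (j + 1) := by
    simp [statesEquiv, add_assoc]
  rw [Equiv.coe_addLeft, h1, h2, edgeLetter_add]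

/-- The cycle is cut at `T`, whose state is `a`. The index `b` is the state of the node just before
`T`, and the last factor is the condition on the edge closing the cycle. -/
theorem sum_isLowerSet (T : Fin (n + 1)) (a : Bool) (S : Finset (Finset (Fin (n + 1))))
    (hS : ∀ I, I ∈ S ↔
      @IsLowerSet (CircularFence c hc) _ (I : Set (Fin (n + 1))) ∧ decide (T ∈ I) = a) :
    ∑ I ∈ S, (X ^ I.card : ℤ[X]) =
    ∑ b, pathSum ((List.range n).map fun j => edgeLetter c (T + j)) a b *
      (if edgeOK (edgeLetter c (T + n)) b a then 1 else 0) := by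
  classical
  have hS' : S = Finset.univ.filter fun I : Finset (Fin (n + 1)) =>
      @IsLowerSet (CircularFence c hc) _ (I : Set (Fin (n + 1))) ∧ decide (T ∈ I) = a := by
    ext I
    simp [hS]
  rw [hS']
  simp only [pathSum_map_range, Finset.sum_mul]
  rw [Finset.sum_comm, Finset.sum_filter, ← (statesEquiv T).sum_comp]
  refine Finset.sum_congr rfl fun s _ => ?_
  rw [isLowerSet_statesEquiv, card_statesEquiv]
  have h0 : decide (T ∈ statesEquiv T s) = s 0 := by simp [statesEquiv]
  have e : (∏ j : Fin n, if edgeOK (edgeLetter c (T + j)) (s j.castSucc) (s j.succ) = true then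
      (1 : ℤ[X]) else 0) * (if edgeOK (edgeLetter c (T + n)) (s (Fin.last n)) (s 0) then 1 else 0) =
      if ∀ j : Fin (n + 1), edgeOK (edgeLetter c ((T : ℕ) + j)) (s j) (s (j + 1)) = true then 1
      else 0 := by
    have := Finset.prod_ite_zero (s := (Finset.univ : Finset (Fin (n + 1))))
      (p := fun j : Fin (n + 1) => edgeOK (edgeLetter c ((T : ℕ) + j)) (s j) (s (j + 1)) = true)
      (f := fun _ => (1 : ℤ[X]))
    simp only [Finset.mem_univ, true_imp_iff, Finset.prod_const_one] at this
    rw [← this, Fin.prod_univ_castSucc]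
    simp [Fin.coeSucc_eq_succ]
  rw [Finset.sum_eq_single (s (Fin.last n))]
  · by_cases ha : s 0 = a
    · rw [h0, if_pos ha, if_pos rfl, mul_one, one_mul, mul_right_comm, ← ha, e]
      split_ifs <;> simp_all
    · rw [h0]
      simp [ha]
  · intro b _ hb
    simp [hb.symm]
  · simp

end CircularFence

/-! ### Return to natural coefficients -/

theorem zcoeff_map (p : ℕ[X]) (i : ℕ) : zcoeff (p.map (Nat.castRingHom ℤ)) i = p.coeff i := by
  simp [zcoeff_natCast]

theorem polyUnimodal_of_increasingToMiddle {p : ℕ[X]} {N : ℕ} (hN : p.natDegree = N)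
    (hsym : ∀ i : ℤ, zcoeff (p.map (Nat.castRingHom ℤ)) i =
      zcoeff (p.map (Nat.castRingHom ℤ)) (N - i))
    (hinc : IncreasingToMiddle N (p.map (Nat.castRingHom ℤ))) : PolyUnimodal p := by
  have hup : ∀ i : ℕ, 2 * (i + 1) ≤ N → p.coeff i ≤ p.coeff (i + 1) := fun i hi => by
    have := hinc i (by omega)
    rw [zcoeff_map, ← Nat.cast_succ, zcoeff_map] at this
    exact_mod_cast this
  have hs : ∀ i j : ℕ, i + j = N → p.coeff i = p.coeff j := fun i j hij => by
    have := hsym i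
    rw [show (N : ℤ) - i = j by omega, zcoeff_map, zcoeff_map] at this
    exact_mod_cast this
  rw [PolyUnimodal, hN]
  refine ⟨N / 2, by omega, fun i hi => hup i (by omega), fun i hi hiN => ?_⟩
  rcases Nat.lt_or_ge (2 * i) N with h | h
  · exact (hs (i + 1) i (by omega)).le
  · rw [hs i (N - (i + 1) + 1) (by omega), hs (i + 1) (N - (i + 1)) (by omega)]
    exact hup _ (by omega)

theorem PolyTopInterlacing.topHeavy {p : ℕ[X]} (h : PolyTopInterlacing p) :
    TopHeavy p.natDegree (zcoeff (p.map (Nat.castRingHom ℤ))) := by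
  intro i j hij hs
  rcases lt_or_ge i 0 with hi | hi
  · have h0 : zcoeff (p.map (Nat.castRingHom ℤ)) i = 0 := if_neg (by omega)
    obtain ⟨j, rfl⟩ := Int.eq_ofNat_of_zero_le (show 0 ≤ j by omega)
    rw [h0, zcoeff_map]
    positivity
  · obtain ⟨i, rfl⟩ := Int.eq_ofNat_of_zero_le hi
    obtain ⟨j, rfl⟩ := Int.eq_ofNat_of_zero_le (show 0 ≤ j by omega)
    rw [zcoeff_map, zcoeff_map]
    rcases Nat.lt_or_ge (2 * i) p.natDegree with h1 | h1
    · have := (h i).1 h1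
      rw [show p.natDegree - i = j by omega] at this
      exact_mod_cast this
    · rw [show j = i by omega]

theorem mem_filter_univ_iff {α : Type*} {_ : Fintype α} {p : α → Prop} {_ : DecidablePred p}
    (a : α) : a ∈ Finset.univ.filter p ↔ p a := by simp

/-! ### Circular fences read from an arbitrary node -/

namespace CircularFence

variable {n : ℕ} {c : Composition (n + 1)} {hc : Even c.length}

theorem edgeLetter_congr {a b : ℕ} (h : a ≡ b [MOD n + 1]) :
    edgeLetter c a = edgeLetter c b := by
  have h' : a % (n + 1) = b % (n + 1) := h
  simp only [edgeLetter, h']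

theorem map_rankPolynomial (p : ℕ) :
    (rankPolynomial (CircularFence c hc)).map (Nat.castRingHom ℤ) =
      cycleSum ((List.range n).map fun j => edgeLetter c (p + j)) (edgeLetter c (p + n)) := by
  let T : Fin (n + 1) := ⟨p % (n + 1), Nat.mod_lt _ n.succ_pos⟩
  have hT : ∀ j, edgeLetter c (p + j) = edgeLetter c ((T : ℕ) + j) := fun j =>
    edgeLetter_congr ((Nat.mod_modEq p (n + 1)).symm.add_right j)
  rw [rankPolynomial_eq_add (P := CircularFence c hc) T, Polynomial.map_add, Polynomial.map_sum,
    Polynomial.map_sum]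
  simp only [Polynomial.map_pow, Polynomial.map_X, hT]
  rw [cycleSum, Fintype.sum_bool, add_comm]
  refine congrArg₂ (· + ·) (sum_isLowerSet (hc := hc) T true _ fun I => ?_)
    (sum_isLowerSet (hc := hc) T false _ fun I => ?_)
  · rw [decide_eq_true_eq]
    exact mem_filter_univ_iff I
  · rw [decide_eq_false_iff_not]
    exact mem_filter_univ_iff I

/-- The number of a node. -/
def toFin (T : CircularFence c hc) : Fin (n + 1) := T

theorem map_rankPolynomial_ne {T : CircularFence c hc} (hT : IsMax T) :
    (rankPolynomial {x : CircularFence c hc // x ≠ T}).map (Nat.castRingHom ℤ) =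
      ∑ b, pathSum ((List.range n).map fun j => edgeLetter c (toFin T + j)) false b *
      (if edgeOK (edgeLetter c (toFin T + n)) b false then 1 else 0) := by
  rw [rankPolynomial_ne hT, Polynomial.map_sum]
  simp only [Polynomial.map_pow, Polynomial.map_X]
  refine sum_isLowerSet (hc := hc) (toFin T) false _ fun I => ?_
  rw [decide_eq_false_iff_not]
  exact mem_filter_univ_iff I

theorem not_step_of_isMax {T x : Fin (n + 1)} (hT : @IsMax (CircularFence c hc) _ T) :
    ¬ Step c T x := fun hs => by
  have hle : @LE.le (CircularFence c hc) _ T x := Relation.ReflTransGen.single hs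
  exact (height_lt_of_step hc hs).ne (congrArg (height c) (hT.eq_of_le hle))

theorem edgeLetter_of_isMax {T : Fin (n + 1)} (hT : @IsMax (CircularFence c hc) _ T) :
    edgeLetter c T = false := by
  rw [edgeLetter_val, decide_eq_false_iff_not]
  exact fun h => not_step_of_isMax hT (Or.inl ⟨h, rfl⟩)

theorem edgeLetter_pred_of_isMax {T : Fin (n + 1)} (hT : @IsMax (CircularFence c hc) _ T) :
    edgeLetter c (T + n) = true := by
  have e : ((T + Fin.last n : Fin (n + 1)) : ℕ) = ((T : ℕ) + n) % (n + 1) := by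
    rw [Fin.val_add, Fin.val_last]
  have hsucc : cyclicSucc (T + Fin.last n) = T := by
    rw [cyclicSucc_eq_add_one, add_assoc, Fin.last_add_one, add_zero]
  rw [← edgeLetter_congr (Nat.mod_modEq _ _), ← e, edgeLetter_val, decide_eq_true_eq]
  by_contra h
  exact not_step_of_isMax hT (Or.inr ⟨Nat.not_even_iff_odd.1 h, hsucc.symm⟩)

theorem card_eq : Fintype.card (CircularFence c hc) = n + 1 := Fintype.card_fin _

theorem polyUnimodal_of_cycleSum {w : List Bool} {b : Bool} (hw : w.length = n)
    (h : (rankPolynomial (CircularFence c hc)).map (Nat.castRingHom ℤ) = cycleSum w b)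
    (hinc : IncreasingToMiddle (n + 1) (cycleSum w b)) :
    PolyUnimodal (rankPolynomial (CircularFence c hc)) := by
  refine polyUnimodal_of_increasingToMiddle (N := n + 1) (by rw [natDegree_rankPolynomial, card_eq])
    (fun i => ?_) (by rwa [h])
  rw [h, zcoeff_cycleSum, hw]
  push_cast
  rfl

theorem polyUnimodal_of_topInterlacing {T : CircularFence c hc} (hT : IsMax T)
    (h : PolyTopInterlacing (rankPolynomial {x : CircularFence c hc // x ≠ T})) :
    PolyUnimodal (rankPolynomial (CircularFence c hc)) := by
  have h0 := edgeLetter_of_isMax (T := toFin T) hT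
  have h1 := edgeLetter_pred_of_isMax (T := toFin T) hT
  have h2 := map_rankPolynomial_ne hT
  have h3 := map_rankPolynomial (c := c) (hc := hc) (toFin T)
  -- With a single node, the edges entering and leaving `T` would coincide, though one goes up and
  -- the other down.
  obtain ⟨m, rfl⟩ : ∃ m, n = m + 1 := by
    rcases n with _ | m
    · rw [add_zero, h0] at h1
      exact absurd h1 (by simp)
    · exact ⟨m, rfl⟩
  have hd := h.topHeavy
  have hcard : Fintype.card {x : CircularFence c hc // x ≠ T} = m + 1 := by
    rw [Fintype.card_subtype_compl, Fintype.card_subtype_eq, card_eq, Nat.add_sub_cancel]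
  rw [natDegree_rankPolynomial, hcard, h2] at hd
  rw [h1] at h3 hd
  rw [List.range_succ_eq_map, List.map_cons, add_zero, h0, List.map_map] at h3 hd
  set w := (List.range m).map ((fun j => edgeLetter c (toFin T + j)) ∘ Nat.succ)
    with hw
  have hl : w.length = m := by simp [hw]
  refine polyUnimodal_of_cycleSum (by simp [hl]) h3 fun i hi => ?_
  apply zcoeff_cycleSum_le_of_topHeavy
  · rw [hl]
    convert hd using 2
    · simp
    -- Both edges at a maximal node outside the ideal impose no condition, so the sum runs over all
    -- ideals of the remaining fence.
    · simp [edgeOK, pathSum_down_false, fenceSum_eq]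
      ring
  · rw [hl]
    push_cast at hi
    omega

/-- Rotation and dualization combined: directions may be measured relative to any chosen `u`, so a
valley can be treated as a peak. -/
theorem map_rankPolynomial_beq (u : Bool) (p : ℕ) :
    (rankPolynomial (CircularFence c hc)).map (Nat.castRingHom ℤ) =
      cycleSum ((List.range n).map fun j => edgeLetter c (p + j) == u)
        (edgeLetter c (p + n) == u) := by
  rw [map_rankPolynomial p]
  cases u
  · rw [← cycleSum_not]
    simp [Function.comp_def]
  · simp

theorem sizeUpTo_add_blocksFun (i : Fin c.length) :
    c.sizeUpTo i + c.blocksFun i ≡ c.sizeUpTo (cyclicSucc i) [MOD n + 1] := by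
  rw [← c.sizeUpTo_succ']
  have e : (cyclicSucc i : ℕ) = (i + 1) % c.length := rfl
  rcases Nat.lt_or_ge ((i : ℕ) + 1) c.length with h | h
  · rw [e, Nat.mod_eq_of_lt h]
  · have h' : (i : ℕ) + 1 = c.length := by omega
    rw [e, h', Nat.mod_self, c.sizeUpTo_length, c.sizeUpTo_zero]
    exact (Nat.modEq_zero_iff_dvd).2 dvd_rfl

theorem even_cyclicSucc {N : ℕ} (hN : Even N) (i : Fin N) :
    Even (cyclicSucc i : ℕ) ↔ ¬ Even (i : ℕ) := by
  have e : (cyclicSucc i : ℕ) = (i + 1) % N := rfl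
  rcases Nat.lt_or_ge ((i : ℕ) + 1) N with h | h
  · rw [e, Nat.mod_eq_of_lt h, Nat.even_add_one]
  · have h' : (i : ℕ) + 1 = N := by omega
    rw [← h', Nat.even_add_one] at hN
    rw [e, h', Nat.mod_self]
    simpa using hN

theorem ne_cyclicSucc {N : ℕ} (hN : Even N) (i : Fin N) : i ≠ cyclicSucc i := fun h => by
  have := even_cyclicSucc hN i
  rw [← h] at this
  tauto

theorem decide_even_cyclicSucc {N : ℕ} (hN : Even N) (i : Fin N) :
    decide (Even (cyclicSucc i : ℕ)) = !decide (Even (i : ℕ)) := by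
  simp only [even_cyclicSucc hN, decide_not]

theorem edgeLetter_block {i : Fin c.length} {a : ℕ} (ha : a ≡ c.sizeUpTo i [MOD n + 1])
    {t : ℕ} (ht : t < c.blocksFun i) : edgeLetter c (a + t) = decide (Even (i : ℕ)) := by
  rw [edgeLetter_congr (ha.add_right t)]
  have h1 := c.sizeUpTo_succ' i
  have h2 := c.sizeUpTo_le (i + 1)
  have h3 : c.sizeUpTo i + t < n + 1 := by omega
  rw [show c.sizeUpTo i + t = ((⟨c.sizeUpTo i + t, h3⟩ : Fin (n + 1)) : ℕ) from rfl,
    edgeLetter_val, index_eq_of c ⟨c.sizeUpTo i + t, h3⟩ i (by simp) (by simp only; omega)]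

theorem sum_blocksFun_le (s : Finset (Fin c.length)) : ∑ i ∈ s, c.blocksFun i ≤ n + 1 :=
  (Finset.sum_le_univ_sum_of_nonneg fun _ => Nat.zero_le _).trans_eq c.sum_blocksFun

theorem polyUnimodal_of_two_parts (hc : Even c.length) {i : Fin c.length} (h1 : 1 < c.blocksFun i)
    (h2 : 1 < c.blocksFun (cyclicSucc i)) : PolyUnimodal (rankPolynomial (CircularFence c hc)) := by
  have hne := ne_cyclicSucc hc i
  have hle := sum_blocksFun_le {i, cyclicSucc i}
  rw [Finset.sum_pair hne] at hle
  have e := decide_even_cyclicSucc hc i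
  have ha := sizeUpTo_add_blocksFun i
  have hA := fun t (ht : t < c.blocksFun i) => edgeLetter_block (c := c) rfl ht
  have hB := fun t (ht : t < c.blocksFun (cyclicSucc i)) => edgeLetter_block ha ht
  have hper : ∀ t, edgeLetter c (t + (n + 1)) = edgeLetter c t := fun t =>
    edgeLetter_congr (by simp [Nat.ModEq])
  -- The word starts at the turning point between the two parts. Relative to the parity of `i`, this
  -- is a peak with two up edges before it and two down edges after it.
  refine polyUnimodal_of_cycleSum (by simp) (map_rankPolynomial_beq (decide (Even (i : ℕ)))
    (c.sizeUpTo i + c.blocksFun i)) (increasingToMiddle_of_two_two (by omega) ?_ ?_ ?_ ?_)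
  · rw [hB 0 (by omega)]; simp [e]
  · rw [hB 1 (by omega)]; simp [e]
  · rw [show c.sizeUpTo i + c.blocksFun i + (n - 1) =
      c.sizeUpTo i + (c.blocksFun i - 2) + (n + 1) by omega, hper, hA _ (by omega)]
    simp
  · rw [show c.sizeUpTo i + c.blocksFun i + n =
      c.sizeUpTo i + (c.blocksFun i - 1) + (n + 1) by omega, hper, hA _ (by omega)]
    simp

theorem cyclicSucc_surjective {N : ℕ} : Function.Surjective (cyclicSucc (n := N)) := by
  rcases N with _ | N
  · exact fun i => i.elim0
  · exact fun i => ⟨i - 1, by rw [cyclicSucc_eq_add_one, sub_add_cancel]⟩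

theorem polyUnimodal_of_three_parts (hc : Even c.length) {i : Fin c.length}
    (h1 : c.blocksFun (cyclicSucc i) = 1)
    (h2 : c.blocksFun (cyclicSucc (cyclicSucc i)) + 1 < c.blocksFun i ∨
      c.blocksFun i + 1 < c.blocksFun (cyclicSucc (cyclicSucc i))) :
    PolyUnimodal (rankPolynomial (CircularFence c hc)) := by
  -- The preceding part is needed for the letter just before the part `i`. It may coincide with the
  -- third successor of `i`.
  obtain ⟨i', hi'⟩ := cyclicSucc_surjective i
  have e' := decide_even_cyclicSucc hc i'
  have e1 := decide_even_cyclicSucc hc i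
  have e2 := decide_even_cyclicSucc hc (cyclicSucc i)
  have e3 := decide_even_cyclicSucc hc (cyclicSucc (cyclicSucc i))
  have n01 := ne_cyclicSucc hc i
  have n12 := ne_cyclicSucc hc (cyclicSucc i)
  have n23 := ne_cyclicSucc hc (cyclicSucc (cyclicSucc i))
  have hinj := Finite.injective_iff_surjective.2 (cyclicSucc_surjective (N := c.length))
  have a' := sizeUpTo_add_blocksFun i'
  have a1 := sizeUpTo_add_blocksFun i
  have a2 := (a1.add_right _).trans (sizeUpTo_add_blocksFun (cyclicSucc i))
  have a3 := (a2.add_right _).trans (sizeUpTo_add_blocksFun (cyclicSucc (cyclicSucc i)))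
  -- With only two parts the outer parts would be the same one, contradicting their different sizes;
  -- hence four distinct parts exist.
  have n02 : i ≠ cyclicSucc (cyclicSucc i) := fun h => by rw [← h] at h2; omega
  have n13 : cyclicSucc i ≠ cyclicSucc (cyclicSucc (cyclicSucc i)) := fun h => n02 (hinj h)
  have n03 : i ≠ cyclicSucc (cyclicSucc (cyclicSucc i)) := fun h => by
    rw [← h, e2, e1] at e3
    simp at e3
  rw [hi'] at a' e'
  generalize cyclicSucc (cyclicSucc (cyclicSucc i)) = i3 at *
  generalize cyclicSucc (cyclicSucc i) = i2 at *
  generalize cyclicSucc i = i1 at *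
  have hle := sum_blocksFun_le {i, i1, i2, i3}
  rw [Finset.sum_insert (by simp [*]), Finset.sum_insert (by simp [*]), Finset.sum_pair n23] at hle
  have p' := c.one_le_blocksFun i'
  have p3 := c.one_le_blocksFun i3
  rw [h1] at a2 a3
  have hper : ∀ t, edgeLetter c (t + (n + 1)) = edgeLetter c t := fun t =>
    edgeLetter_congr (by simp [Nat.ModEq])
  have h0' : edgeLetter c (c.sizeUpTo i + n) = decide (Even (i' : ℕ)) := by
    have hb := edgeLetter_block (c := c) (i := i') rfl (t := c.blocksFun i' - 1) (by omega)
    rw [← edgeLetter_congr (a'.add_right n), show c.sizeUpTo i' + c.blocksFun i' + n =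
      c.sizeUpTo i' + (c.blocksFun i' - 1) + (n + 1) by omega, hper, hb]
  have hA := fun t (ht : t < c.blocksFun i) => edgeLetter_block (c := c) rfl ht
  have hB := edgeLetter_block a1 (t := 0) (by omega)
  have hC := fun t (ht : t < c.blocksFun i2) => edgeLetter_block a2 ht
  have hD := edgeLetter_block a3 (t := 0) (by omega)
  generalize hk : c.blocksFun i = k at *
  generalize hl : c.blocksFun i2 = l at *
  rcases h2 with h2 | h2
  -- The start is the peak between the parts of sizes `k` and 1. One of the `k` up edges closes the
  -- cycle, leaving `k - 1` at the end of the word.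
  · refine polyUnimodal_of_cycleSum (by simp) (map_rankPolynomial_beq (decide (Even (i : ℕ)))
      (c.sizeUpTo i + k)) (increasingToMiddle_of_peak (k - 1) l (by omega) (by omega) ?_ ?_ ?_ ?_)
    · rw [hB]; simp [e1]
    · intro j hj
      rw [← add_assoc, hC j hj]; simp [e1, e2]
    · rw [← add_assoc, ← add_zero (_ + _ + _ + l), hD]; simp [e1, e2, e3]
    · intro j hj
      rw [show c.sizeUpTo i + k + (n - (k - 1) + j) = c.sizeUpTo i + j + (n + 1) by omega, hper,
        hA j (by omega)]
      simp
  -- The start is one edge inside the part of size `l`, so that this edge closes the cycle and the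
  -- reversed word begins with the part of size 1. The other `l - 1` edges form the long run.
  · refine polyUnimodal_of_cycleSum (by simp) (map_rankPolynomial_beq (decide (Even (i : ℕ)))
      (c.sizeUpTo i + k + 1 + 1)) (increasingToMiddle_of_peak_reverse (l - 1) k (by omega)
        (by omega) ?_ ?_ ?_ ?_ ?_)
    · intro j hj
      rw [add_assoc _ 1 j, hC (1 + j) (by omega)]; simp [e1, e2]
    · rw [show c.sizeUpTo i + k + 1 + 1 + (n - 2 - k) = c.sizeUpTo i + n by omega, h0']
      simp [e']
    · intro j hj
      rw [show c.sizeUpTo i + k + 1 + 1 + (n - 1 - k + j) = c.sizeUpTo i + j + (n + 1) by omega,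
        hper, hA j hj]
      simp
    · rw [show c.sizeUpTo i + k + 1 + 1 + (n - 1) = c.sizeUpTo i + k + 0 + (n + 1) by omega,
        hper, hB]
      simp [e1]
    · rw [show c.sizeUpTo i + k + 1 + 1 + n = c.sizeUpTo i + k + 1 + 0 + (n + 1) by omega,
        hper, hC 0 (by omega)]
      simp [e1, e2]

end CircularFence

theorem mainTheorem6 {n : ℕ} (c : Composition n) (hc : Even c.length) :
    (∀ T : CircularFence c hc, IsMax T →
      PolyTopInterlacing (rankPolynomial {x : CircularFence c hc // x ≠ T}) →
      PolyUnimodal (rankPolynomial (CircularFence c hc))) ∧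
    (((∃ i : Fin c.length, 1 < c.blocksFun i ∧ 1 < c.blocksFun (cyclicSucc i)) ∨
      (∃ i : Fin c.length, c.blocksFun (cyclicSucc i) = 1 ∧
        1 < |(c.blocksFun i : ℤ) - (c.blocksFun (cyclicSucc (cyclicSucc i)) : ℤ)|)) →
      PolyUnimodal (rankPolynomial (CircularFence c hc))) := by
  rcases n with _ | n
  · refine ⟨fun T => Fin.elim0 T, ?_⟩
    have h := c.length_le
    rintro (⟨i, _⟩ | ⟨i, _⟩) <;> exact absurd i.2 (by omega)
  · refine ⟨fun T hT h => CircularFence.polyUnimodal_of_topInterlacing hT h, ?_⟩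
    rintro (⟨i, h1, h2⟩ | ⟨i, h1, h2⟩)
    · exact CircularFence.polyUnimodal_of_two_parts hc h1 h2
    · refine CircularFence.polyUnimodal_of_three_parts hc h1 ?_
      rw [lt_abs] at h2
      omega
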